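/- **Theorem 6.12.** A *pseudo hoop* is an algebra $(M;\odot,\to,\rightsquigarrow,1)$ of type $\langle 2,2,2,0\rangle$ such that, for all $x,y,z\in M$: $x\odot 1=x=1\odot x$; $x\to x=1=x\rightsquigarrow x$; $(x\odot y)\to z=x\to(y\to z)$; $(x\odot y)\rightsquigarrow z=y\rightsquigarrow(x\rightsquigarrow z)$; and $(x\to y)\odot x=(y\to x)\odot y=x\odot(x\rightsquigarrow y)=y\odot(y\rightsquigarrow x)$. It is ordered by $x\le y$ iff $x\to y=1$. It is *basic* if $(x\to y)\to z\le((y\to x)\to z)\to z$ and $(x\rightsquigarrow y)\rightsquigarrow z\le((y\rightsquigarrow x)\rightsquigarrow z)\rightsquigarrow z$ for all $x,y,z\in M$. A *filter* of $M$ is a nonempty subset that is closed under $\odot$ and upward closed. A *value* of an element $g\in M\setminus\{1\}$ is a filter $V$ that is maximal among the filters not containing $g$; its *cover* $V^*$ is the filter generated by $V\cup\{g\}$. The value $V$ is *normal in $V^*$* if, for all $x,y\in V^*$, $x\to y\in V$ if and only if $x\rightsquigarrow y\in V$. A basic pseudo hoop is *normal-valued* if every value $V$ (of any $g\ne 1$)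 is normal in its cover $V^*$. Let $M$ be a basic pseudo hoop satisfying $$(x\to y)\rightsquigarrow y=(x\rightsquigarrow y)\to y\qquad\text{for all }x,y\in M.$$ Then $M$ is normal-valued if and only if $x^2\odot y^2\le y\odot x$ for all $x,y\in M$, where $x^2=x\odot x$. -/

import Mathlib

/-- A pseudo hoop `(M; ⊙, →, ⇝, 1)`; the product `⊙` is written `*`. -/
class PseudoHoop (M : Type*) extends MulOneClass M where
  /-- the arrow `→` -/
  limp : M → M → M
  /-- the arrow `⇝` -/
  rimp : M → M → M
  limp_self : ∀ x : M, limp x x = 1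
  rimp_self : ∀ x : M, rimp x x = 1
  mul_limp : ∀ x y z : M, limp (x * y) z = limp x (limp y z)
  mul_rimp : ∀ x y z : M, rimp (x * y) z = rimp y (rimp x z)
  limp_mul_comm : ∀ x y : M, limp x y * x = limp y x * y
  limp_mul_eq_mul_rimp : ∀ x y : M, limp y x * y = x * rimp x y
  mul_rimp_comm : ∀ x y : M, x * rimp x y = y * rimp y x

infixr:60 " →ₕ " => PseudoHoop.limp
infixr:60 " ⇝ₕ " => PseudoHoop.rimp

namespace PseudoHoop

/-- The order of a pseudo hoop: `x ≤ y` iff `x → y = 1`. -/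
instance instLE {M : Type*} [PseudoHoop M] : LE M := ⟨fun x y => x →ₕ y = 1⟩

/-- A pseudo hoop is basic if it satisfies (B1) and (B2). -/
structure IsBasic (M : Type*) [PseudoHoop M] : Prop where
  b1 : ∀ x y z : M, (x →ₕ y) →ₕ z ≤ ((y →ₕ x) →ₕ z) →ₕ z
  b2 : ∀ x y z : M, (x ⇝ₕ y) ⇝ₕ z ≤ ((y ⇝ₕ x) ⇝ₕ z) ⇝ₕ z

/-- Filters: (nonempty) upward closed subsets that are closed under the product. -/
structure IsFilter {M : Type*} [PseudoHoop M] (F : Set M) : Prop where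
  one_mem : (1 : M) ∈ F
  mul_mem : ∀ x y : M, x ∈ F → y ∈ F → x * y ∈ F
  up_mem : ∀ x y : M, x ≤ y → x ∈ F → y ∈ F

/-- The filter generated by a subset. -/
def filterGen {M : Type*} [PseudoHoop M] (S : Set M) : Set M :=
  ⋂₀ {F | IsFilter F ∧ S ⊆ F}

/-- `V` is a value of `g`: a filter maximal with respect to not containing `g`. -/
def IsValue {M : Type*} [PseudoHoop M] (g : M) (V : Set M) : Prop :=
  Maximal (fun F : Set M => IsFilter F ∧ g ∉ F) V

/-- The cover of a value `V` of `g`: the filter generated by `V` and `g`. -/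
def cover {M : Type*} [PseudoHoop M] (g : M) (V : Set M) : Set M :=
  filterGen (insert g V)

/-- `V` is a normal filter of the pseudo hoop formed by the filter `W`. -/
def IsNormalIn {M : Type*} [PseudoHoop M] (V W : Set M) : Prop :=
  ∀ x ∈ W, ∀ y ∈ W, (x →ₕ y ∈ V ↔ x ⇝ₕ y ∈ V)

/-- Every value (of an element `g ≠ 1`) is normal in its cover. -/
def IsNormalValued (M : Type*) [PseudoHoop M] : Prop :=
  ∀ (g : M) (V : Set M), g ≠ 1 → IsValue g V → IsNormalIn V (cover g V)

end PseudoHoop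

/-! Forward: in a normal-valued `M`, suppose `x²y² → yx` is not 1. Take a value `V` of it and a
value `W ⊇ V` of `xy`. Modulo `W` the cover is an archimedean chain, so `xy² ≤ yx` there. Since `V`
is prime, an element outside `W` lies, modulo `V`, below every element of `W`; this absorbs the
error in `W` at the cost of one more factor. Backward: put `a = x → y`, `b = x ⇝ y`. The assumed
identity makes `z = a ⇝ y = b → y` a single element above `x`, with `az = y = zb`. If `a ∈ V` but `b
∉ V`, then modulo `V` every `bⁿ → z` lies below `z`, while some `bⁿ` lies below `z`. So `z ∈ V`,
whence `y = az ∈ V` and `b ≥ y` is in `V`, a contradiction. The other case is dual. -/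

namespace PseudoHoop

variable {M : Type*} [PseudoHoop M]

/-! ### Order and residuation -/

theorem le_iff_limp {x y : M} : x ≤ y ↔ x →ₕ y = 1 := Iff.rfl

theorem antisymm_of_limp {x y : M} (hxy : x →ₕ y = 1) (hyx : y →ₕ x = 1) : x = y := by
  have := limp_mul_comm x y
  rwa [hxy, hyx, one_mul, one_mul] at this

theorem one_limp (z : M) : 1 →ₕ z = z := by
  have key : ∀ x : M, x →ₕ (1 →ₕ z) = x →ₕ z := fun x => by rw [← mul_limp, mul_one]
  apply antisymm_of_limp
  · rw [← key, limp_self]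
  · rw [key, limp_self]

theorem limp_one (z : M) : z →ₕ (1 : M) = 1 := by
  have h : (z →ₕ 1) * z = z := by rw [limp_mul_comm, one_limp, mul_one]
  calc z →ₕ (1 : M) = ((z →ₕ 1) * z) →ₕ 1 := by rw [h]
    _ = 1 := by rw [mul_limp, limp_self]

theorem le_of_rimp {x y : M} (h : x ⇝ₕ y = 1) : x ≤ y := by
  have hx : x = (y →ₕ x) * y := by rw [limp_mul_eq_mul_rimp, h, mul_one]
  rw [le_iff_limp]
  calc x →ₕ y = ((y →ₕ x) * y) →ₕ y := by rw [← hx]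
    _ = 1 := by rw [mul_limp, limp_self, limp_one]

theorem one_rimp (z : M) : 1 ⇝ₕ z = z := by
  have key : ∀ x : M, x ⇝ₕ (1 ⇝ₕ z) = x ⇝ₕ z := fun x => by rw [← mul_rimp, one_mul]
  apply antisymm_of_limp
  · exact le_of_rimp (by rw [← key, rimp_self])
  · exact le_of_rimp (by rw [key, rimp_self])

theorem rimp_one (z : M) : z ⇝ₕ (1 : M) = 1 := by
  have h : z * (z ⇝ₕ 1) = z := by rw [mul_rimp_comm, one_rimp, one_mul]
  calc z ⇝ₕ (1 : M) = (z * (z ⇝ₕ 1)) ⇝ₕ 1 := by rw [h]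
    _ = 1 := by rw [mul_rimp, rimp_self]

theorem le_iff_rimp {x y : M} : x ≤ y ↔ x ⇝ₕ y = 1 := by
  refine ⟨fun h => ?_, le_of_rimp⟩
  have hx : x = y * (y ⇝ₕ x) := by
    rw [mul_rimp_comm, ← limp_mul_eq_mul_rimp, limp_mul_comm, le_iff_limp.1 h, one_mul]
  calc x ⇝ₕ y = (y * (y ⇝ₕ x)) ⇝ₕ y := by rw [← hx]
    _ = 1 := by rw [mul_rimp, rimp_self, rimp_one]

instance instPartialOrder : PartialOrder M where
  le_refl := limp_self
  le_trans x y z hxy hyz := by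
    have hx : x = (y →ₕ x) * y := by rw [limp_mul_comm, le_iff_limp.1 hxy, one_mul]
    rw [le_iff_limp, hx, mul_limp, le_iff_limp.1 hyz, limp_one]
  le_antisymm _ _ := antisymm_of_limp

theorem mul_le_iff_le_limp {x y z : M} : x * y ≤ z ↔ x ≤ y →ₕ z := by
  rw [le_iff_limp, le_iff_limp, mul_limp]

theorem mul_le_iff_le_rimp {x y z : M} : x * y ≤ z ↔ y ≤ x ⇝ₕ z := by
  rw [le_iff_rimp, le_iff_rimp, mul_rimp]

instance instMonoid : Monoid M where
  mul_assoc x y z := by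
    -- Associativity is not an axiom: by residuation both products have the same upper bounds.
    refine eq_of_forall_ge_iff fun w => ?_
    rw [mul_le_iff_le_limp, mul_le_iff_le_limp, ← mul_limp, ← mul_le_iff_le_limp]

instance instMulLeftMono : MulLeftMono M where
  elim _ _ _ h := mul_le_iff_le_rimp.2 (h.trans (mul_le_iff_le_rimp.1 le_rfl))

instance instMulRightMono : MulRightMono M where
  elim _ _ _ h := mul_le_iff_le_limp.2 (h.trans (mul_le_iff_le_limp.1 le_rfl))

theorem le_one (x : M) : x ≤ 1 := limp_one x

theorem mul_le_left (x y : M) : x * y ≤ x := mul_le_of_le_one_right' (le_one y)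

theorem mul_le_right (x y : M) : x * y ≤ y := mul_le_of_le_one_left' (le_one x)

theorem limp_mul_le (x y : M) : (x →ₕ y) * x ≤ y := mul_le_iff_le_limp.2 le_rfl

theorem mul_rimp_le (x y : M) : x * (x ⇝ₕ y) ≤ y := mul_le_iff_le_rimp.2 le_rfl

theorem limp_mul_of_le {x y : M} (h : y ≤ x) : (x →ₕ y) * x = y := by
  rw [limp_mul_comm, le_iff_limp.1 h, one_mul]

theorem mul_rimp_of_le {x y : M} (h : y ≤ x) : x * (x ⇝ₕ y) = y := by
  rw [mul_rimp_comm, le_iff_rimp.1 h, mul_one]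

theorem le_limp (x y : M) : y ≤ x →ₕ y := mul_le_iff_le_limp.1 (mul_le_left y x)

theorem le_rimp (x y : M) : y ≤ x ⇝ₕ y := mul_le_iff_le_rimp.1 (mul_le_right x y)

/-! ### Filters -/

namespace IsFilter

variable {F : Set M}

theorem mem_of_limp (hF : IsFilter F) {x y : M} (h : x →ₕ y ∈ F) (hx : x ∈ F) : y ∈ F :=
  hF.up_mem _ _ (limp_mul_le x y) (hF.mul_mem _ _ h hx)

theorem mem_of_rimp (hF : IsFilter F) {x y : M} (h : x ⇝ₕ y ∈ F) (hx : x ∈ F) : y ∈ F :=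
  hF.up_mem _ _ (mul_rimp_le x y) (hF.mul_mem _ _ hx h)

theorem pow_mem (hF : IsFilter F) {x : M} (hx : x ∈ F) (n : ℕ) : x ^ n ∈ F := by
  induction n with
  | zero => simpa using hF.one_mem
  | succ n ih => rw [pow_succ]; exact hF.mul_mem _ _ ih hx

theorem limp_mem_iff (hF : IsFilter F) {x y : M} : x →ₕ y ∈ F ↔ ∃ v ∈ F, v * x ≤ y :=
  ⟨fun h => ⟨_, h, limp_mul_le x y⟩,
    fun ⟨_, hv, h⟩ => hF.up_mem _ _ (mul_le_iff_le_limp.1 h) hv⟩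

theorem rimp_mem_iff (hF : IsFilter F) {x y : M} :
    x ⇝ₕ y ∈ F ↔ ∃ v ∈ F, x * v ≤ y :=
  ⟨fun h => ⟨_, h, mul_rimp_le x y⟩,
    fun ⟨_, hv, h⟩ => hF.up_mem _ _ (mul_le_iff_le_rimp.1 h) hv⟩

end IsFilter

theorem isFilter_filterGen (S : Set M) : IsFilter (filterGen S) where
  one_mem _ hF := hF.1.one_mem
  mul_mem x y hx hy F hF := hF.1.mul_mem x y (hx F hF) (hy F hF)
  up_mem x y hxy hx F hF := hF.1.up_mem x y hxy (hx F hF)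

theorem subset_filterGen (S : Set M) : S ⊆ filterGen S := fun _ hx _ hF => hF.2 hx

theorem subset_cover (g : M) (V : Set M) : V ⊆ cover g V :=
  (Set.subset_insert g V).trans (subset_filterGen _)

theorem mem_cover (g : M) (V : Set M) : g ∈ cover g V :=
  subset_filterGen _ (Set.mem_insert g V)

/-! ### Values, covers and primality -/

/-- Every filter omitting `g` extends to a value of `g`. -/
theorem exists_isValue {F : Set M} (hF : IsFilter F) {g : M} (hg : g ∉ F) :
    ∃ V, F ⊆ V ∧ IsValue g V := by
  refine zorn_subset_nonempty {F : Set M | IsFilter F ∧ g ∉ F} ?_ F ⟨hF, hg⟩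
  intro c hc hchain ⟨A, hA⟩
  refine ⟨⋃₀ c, ⟨⟨⟨A, hA, (hc hA).1.one_mem⟩, ?_, ?_⟩, ?_⟩, fun s hs => Set.subset_sUnion_of_mem hs⟩
  · rintro x y ⟨s, hs, hxs⟩ ⟨t, ht, hyt⟩
    rcases hchain.total hs ht with h | h
    · exact ⟨t, ht, (hc ht).1.mul_mem _ _ (h hxs) hyt⟩
    · exact ⟨s, hs, (hc hs).1.mul_mem _ _ hxs (h hyt)⟩
  · rintro x y hxy ⟨s, hs, hxs⟩
    exact ⟨s, hs, (hc hs).1.up_mem _ _ hxy hxs⟩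
  · rintro ⟨s, hs, hgs⟩
    exact (hc hs).2 hgs

namespace IsValue

variable {g : M} {V : Set M}

theorem isFilter (hV : IsValue g V) : IsFilter V := hV.prop.1

theorem notMem (hV : IsValue g V) : g ∉ V := hV.prop.2

/-- A filter properly containing a value of `g` contains `g`. -/
theorem mem_of_subset (hV : IsValue g V) {F : Set M} (hF : IsFilter F) (hVF : V ⊆ F) {b : M}
    (hb : b ∈ F) (hbV : b ∉ V) : g ∈ F := by
  by_contra hg
  exact hbV (hV.le_of_ge ⟨hF, hg⟩ hVF hb)

/-- A filter properly containing a value contains its cover. -/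
theorem cover_subset (hV : IsValue g V) {F : Set M} (hF : IsFilter F) (hVF : V ⊆ F) {b : M}
    (hb : b ∈ F) (hbV : b ∉ V) : cover g V ⊆ F :=
  Set.sInter_subset_of_mem ⟨hF, Set.insert_subset (hV.mem_of_subset hF hVF hb hbV) hVF⟩

/-- The elements all of whose common upper bounds with `b` lie in the filter `V`. -/
theorem isFilter_upperBounds (hV : IsFilter V) (b : M) :
    IsFilter {c : M | ∀ z, c ≤ z → b ≤ z → z ∈ V} where
  one_mem z hz _ := hV.up_mem _ _ hz hV.one_mem
  mul_mem c d hc hd z hz hbz := by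
    have hw : c ⇝ₕ z ∈ V := hd _ (mul_le_iff_le_rimp.1 hz) (hbz.trans (le_rimp c z))
    exact hV.mem_of_limp
      (hc _ (mul_le_iff_le_limp.1 (mul_rimp_le c z)) (hbz.trans (le_limp _ z))) hw
  up_mem _ _ hcd hc z hz hbz := hc z (hcd.trans hz) hbz

/-- In a basic pseudo hoop, values are prime. -/
theorem limp_mem_or (hM : IsBasic M) (hV : IsValue g V) (x y : M) :
    x →ₕ y ∈ V ∨ y →ₕ x ∈ V := by
  by_contra! hcon
  obtain ⟨ha, hb⟩ := hcon
  have hF := isFilter_upperBounds hV.isFilter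
  have hsub : ∀ b : M, V ⊆ {c : M | ∀ z, c ≤ z → b ≤ z → z ∈ V} :=
    fun b c hc z hz _ => hV.isFilter.up_mem _ _ hz hc
  -- By (B1), 1 is the only common upper bound of `x → y` and `y → x`. Maximality of `V` is used
  -- twice: it replaces first `x → y`, then `y → x`, by `g`, leaving `g` as a common upper bound of
  -- `g` and `g`.
  have hg := hV.mem_of_subset (hF (y →ₕ x)) (hsub _) (b := x →ₕ y) (fun z hxz hyz => by
    have := hM.b1 x y z
    rw [le_iff_limp.1 hxz, le_iff_limp.1 hyz, one_limp, le_iff_limp, one_limp] at this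
    exact this ▸ hV.isFilter.one_mem) ha
  have hg' := hV.mem_of_subset (hF g) (hsub _) (b := y →ₕ x)
    (fun z hyz hgz => hg z hgz hyz) hb
  exact hV.notMem (hg' g le_rfl le_rfl)

/-- Modulo a prime filter `V ⊆ W`, elements outside `W` lie below those of `W`. -/
theorem limp_mem_of_notMem (hM : IsBasic M) (hV : IsValue g V) {W : Set M} (hW : IsFilter W)
    (hVW : V ⊆ W) {p t : M} (hp : p ∉ W) (ht : t ∈ W) : p →ₕ t ∈ V :=
  (hV.limp_mem_or hM p t).resolve_right fun h => hp (hW.mem_of_limp (hVW h) ht)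

end IsValue

/-! ### Normal-valued implies the inequality -/

theorem IsNormalIn.exists_mul_le {V W : Set M} (hn : IsNormalIn V W) (hV : IsFilter V)
    (hW : IsFilter W) (hVW : V ⊆ W) {y v : M} (hy : y ∈ W) (hv : v ∈ V) :
    ∃ w ∈ V, w * y ≤ y * v :=
  hV.limp_mem_iff.1 ((hn y hy (y * v) (hW.mul_mem _ _ hy (hVW hv))).2
    (hV.up_mem _ _ (mul_le_iff_le_rimp.1 le_rfl) hv))

/-- The quotient of the cover by a normal value is archimedean. -/
theorem IsValue.exists_pow_limp_mem {g : M} {W : Set M} (hW : IsValue g W)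
    (hn : IsNormalIn W (cover g W)) {x y : M} (hx : x ∈ cover g W) (hy : y ∈ cover g W)
    (hyW : y ∉ W) : ∃ n : ℕ, y ^ n →ₕ x ∈ W := by
  have hC : IsFilter (cover g W) := isFilter_filterGen _
  have hF : IsFilter {z : M | ∃ n : ℕ, y ^ n →ₕ z ∈ W} := by
    refine ⟨⟨0, by rw [limp_one]; exact hW.isFilter.one_mem⟩, ?_, ?_⟩
    · rintro c d ⟨m, hm⟩ ⟨n, hn'⟩
      obtain ⟨v, hv, hvc⟩ := hW.isFilter.limp_mem_iff.1 hm
      obtain ⟨w, hw, hwd⟩ := hW.isFilter.limp_mem_iff.1 hn'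
      -- Normality moves `w` to the left of `y ^ m`, so powers of `y` multiply modulo `W`.
      obtain ⟨u, hu, huw⟩ := hn.exists_mul_le hW.isFilter hC (subset_cover g W) (hC.pow_mem hy m) hw
      refine ⟨m + n, hW.isFilter.limp_mem_iff.2 ⟨v * u, hW.isFilter.mul_mem _ _ hv hu, ?_⟩⟩
      calc v * u * y ^ (m + n) = v * (u * y ^ m) * y ^ n := by simp only [pow_add, mul_assoc]
        _ ≤ v * (y ^ m * w) * y ^ n := by gcongr
        _ = (v * y ^ m) * (w * y ^ n) := by simp only [mul_assoc]
        _ ≤ c * d := mul_le_mul' hvc hwd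
    · rintro c d hcd ⟨n, hn'⟩
      obtain ⟨v, hv, hvc⟩ := hW.isFilter.limp_mem_iff.1 hn'
      exact ⟨n, hW.isFilter.limp_mem_iff.2 ⟨v, hv, hvc.trans hcd⟩⟩
  refine hW.cover_subset hF (fun v hv => ⟨0, ?_⟩) (b := y) ⟨1, ?_⟩ hyW hx
  · rwa [pow_zero, one_limp]
  · rw [pow_one, limp_self]; exact hW.isFilter.one_mem

/-- In the quotient of the cover by a normal value, `x ⊙ y² ≤ y ⊙ x`. -/
theorem IsValue.mul_mul_limp_mem (hM : IsBasic M) {g : M} {W : Set M} (hW : IsValue g W)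
    (hn : IsNormalIn W (cover g W)) {x y : M} (hx : x ∈ cover g W) (hy : y ∈ cover g W) :
    (x * y * y) →ₕ (y * x) ∈ W := by
  have hF := hW.isFilter
  have hC : IsFilter (cover g W) := isFilter_filterGen _
  rw [hF.limp_mem_iff]
  by_cases hyW : y ∈ W
  · exact ⟨y, hyW, mul_le_mul_right ((mul_le_left _ y).trans (mul_le_left x y)) y⟩
  classical
  have hex := hW.exists_pow_limp_mem hn hx hy hyW
  obtain ⟨w, hw, hwx⟩ := hF.limp_mem_iff.1 (Nat.find_spec hex)
  obtain ⟨u, hu, huy⟩ := hn.exists_mul_le hF hC (subset_cover g W) hy hw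
  have key : u * y ^ (Nat.find hex + 1) ≤ y * x := by
    calc u * y ^ (Nat.find hex + 1) = (u * y) * y ^ Nat.find hex := by rw [pow_succ', mul_assoc]
      _ ≤ (y * w) * y ^ Nat.find hex := by gcongr
      _ = y * (w * y ^ Nat.find hex) := mul_assoc _ _ _
      _ ≤ y * x := by gcongr
  -- For the least `n` with `yⁿ ≤ x` modulo `W`, primality gives `x ≤ yⁿ⁻¹` if `n > 0`, so `xy² ≤
  -- y·yⁿ ≤ yx`.
  rcases hk : Nat.find hex with _ | m
  · rw [hk, zero_add, pow_one] at key
    exact ⟨u, hu, (mul_le_mul_right (mul_le_right _ y) u).trans key⟩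
  · have hm : y ^ m →ₕ x ∉ W := Nat.find_min hex (by omega)
    obtain ⟨v, hv, hvx⟩ := hF.limp_mem_iff.1 ((hW.limp_mem_or hM _ _).resolve_left hm)
    refine ⟨u * v, hF.mul_mem _ _ hu hv, ?_⟩
    calc u * v * (x * y * y) = u * ((v * x) * y * y) := by simp only [mul_assoc]
      _ ≤ u * (y ^ m * y * y) := by gcongr
      _ = u * y ^ (Nat.find hex + 1) := by rw [hk, pow_succ, pow_succ]
      _ ≤ y * x := key

theorem IsNormalValued.sq_mul_sq_le (hM : IsBasic M) (hN : IsNormalValued M) (x y : M) :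
    (x * x) * (y * y) ≤ y * x := by
  have h1 : IsFilter ({1} : Set M) :=
    ⟨rfl, by rintro _ _ rfl rfl; exact mul_one 1, by
      rintro _ y h rfl; exact le_antisymm (le_one y) h⟩
  by_contra hcon
  obtain ⟨V, -, hV⟩ := exists_isValue h1 (g := ((x * x) * (y * y)) →ₕ (y * x)) hcon
  have hxy : x * y ∉ V := fun h => hV.notMem <| hV.isFilter.up_mem _ _ (le_limp _ _) <|
    hV.isFilter.mul_mem _ _ (hV.isFilter.up_mem _ _ (mul_le_right x y) h)
      (hV.isFilter.up_mem _ _ (mul_le_left x y) h)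
  obtain ⟨W, hVW, hW⟩ := exists_isValue hV.isFilter hxy
  have hne : x * y ≠ 1 := fun h => hW.notMem (by rw [h]; exact hW.isFilter.one_mem)
  have hn := hN _ W hne hW
  have hC : IsFilter (cover (x * y) W) := isFilter_filterGen _
  have hx : x ∈ cover (x * y) W := hC.up_mem _ _ (mul_le_left x y) (mem_cover _ _)
  have hy : y ∈ cover (x * y) W := hC.up_mem _ _ (mul_le_right x y) (mem_cover _ _)
  refine hV.notMem (hV.isFilter.limp_mem_iff.2 ?_)
  -- The element outside `W` to be absorbed is `x²y` if `x ∈ W`, and `x` otherwise.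
  by_cases hxW : x ∈ W
  · have hyW : y ∉ W := fun h => hW.notMem (hW.isFilter.mul_mem _ _ hxW h)
    have ht : y →ₕ (y * x) ∈ W :=
      hW.isFilter.limp_mem_iff.2 (hn.exists_mul_le hW.isFilter hC (subset_cover _ _) hy hxW)
    have hp : x * x * y ∉ W := fun h => hyW (hW.isFilter.up_mem _ _ (mul_le_right _ _) h)
    obtain ⟨v, hv, hle⟩ := hV.isFilter.limp_mem_iff.1
      (hV.limp_mem_of_notMem hM hW.isFilter hVW hp ht)
    refine ⟨v, hv, ?_⟩
    calc v * (x * x * (y * y)) = (v * (x * x * y)) * y := by simp only [mul_assoc]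
      _ ≤ (y →ₕ (y * x)) * y := by gcongr
      _ ≤ y * x := limp_mul_le _ _
  · obtain ⟨v, hv, hle⟩ := hV.isFilter.limp_mem_iff.1
      (hV.limp_mem_of_notMem hM hW.isFilter hVW hxW (hW.mul_mul_limp_mem hM hn hx hy))
    refine ⟨v, hv, ?_⟩
    calc v * (x * x * (y * y)) = (v * x) * (x * y * y) := by simp only [mul_assoc]
      _ ≤ ((x * y * y) →ₕ (y * x)) * (x * y * y) := by gcongr
      _ ≤ y * x := limp_mul_le _ _

/-! ### The inequality implies normal-valued -/

/-- Under `x² ⊙ y² ≤ y ⊙ x`, the powers of an element outside a value are cofinal in its cover. -/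
theorem IsValue.exists_mul_pow_le (hsq : ∀ x y : M, (x * x) * (y * y) ≤ y * x) {g : M} {V : Set M}
    (hV : IsValue g V) {b z : M} (hb : b ∉ V) (hz : z ∈ cover g V) :
    ∃ n : ℕ, ∃ v ∈ V, v * b ^ n ≤ z := by
  have hF : IsFilter {z : M | ∃ n : ℕ, ∃ v ∈ V, v * b ^ n ≤ z} := by
    refine ⟨⟨0, 1, hV.isFilter.one_mem, le_one _⟩, ?_, ?_⟩
    · rintro c d ⟨m, v, hv, hc⟩ ⟨n, w, hw, hd⟩
      -- Swapping `b ^ m` and `w` by the inequality squares both.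
      refine ⟨m + m + n, v * (w * w), hV.isFilter.mul_mem _ _ hv (hV.isFilter.mul_mem _ _ hw hw), ?_⟩
      calc v * (w * w) * b ^ (m + m + n)
          = v * ((w * w) * (b ^ m * b ^ m)) * b ^ n := by simp only [pow_add, mul_assoc]
        _ ≤ v * (b ^ m * w) * b ^ n := mul_le_mul_left (mul_le_mul_right (hsq _ _) _) _
        _ = (v * b ^ m) * (w * b ^ n) := by simp only [mul_assoc]
        _ ≤ c * d := mul_le_mul' hc hd
    · rintro c d hcd ⟨n, v, hv, hc⟩
      exact ⟨n, v, hv, hc.trans hcd⟩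
  exact hV.cover_subset hF (fun v hv => ⟨0, v, hv, mul_le_left _ _⟩) (b := b)
    ⟨1, 1, hV.isFilter.one_mem, by simp⟩ hb hz

/-- The mirror image of `IsValue.exists_mul_pow_le`. -/
theorem IsValue.exists_pow_mul_le (hsq : ∀ x y : M, (x * x) * (y * y) ≤ y * x) {g : M} {V : Set M}
    (hV : IsValue g V) {b z : M} (hb : b ∉ V) (hz : z ∈ cover g V) :
    ∃ n : ℕ, ∃ v ∈ V, b ^ n * v ≤ z := by
  have hF : IsFilter {z : M | ∃ n : ℕ, ∃ v ∈ V, b ^ n * v ≤ z} := by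
    refine ⟨⟨0, 1, hV.isFilter.one_mem, le_one _⟩, ?_, ?_⟩
    · rintro c d ⟨m, v, hv, hc⟩ ⟨n, w, hw, hd⟩
      refine ⟨m + (n + n), (v * v) * w,
        hV.isFilter.mul_mem _ _ (hV.isFilter.mul_mem _ _ hv hv) hw, ?_⟩
      calc b ^ (m + (n + n)) * ((v * v) * w)
          = b ^ m * ((b ^ n * b ^ n) * (v * v)) * w := by simp only [pow_add, mul_assoc]
        _ ≤ b ^ m * (v * b ^ n) * w := mul_le_mul_left (mul_le_mul_right (hsq _ _) _) _
        _ = (b ^ m * v) * (b ^ n * w) := by simp only [mul_assoc]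
        _ ≤ c * d := mul_le_mul' hc hd
    · rintro c d hcd ⟨n, v, hv, hc⟩
      exact ⟨n, v, hv, hc.trans hcd⟩
  exact hV.cover_subset hF (fun v hv => ⟨0, v, hv, mul_le_right _ _⟩) (b := b)
    ⟨1, 1, hV.isFilter.one_mem, by simp⟩ hb hz

/-- Since `bⁿ⁺¹ → x = b → (bⁿ → x)`, a bound `bⁿ → x ≤ x` modulo `V` reduces the exponent to 1. -/
theorem IsFilter.pow_limp_limp_mem {V : Set M} (hV : IsFilter V) {b x : M}
    (h : (b →ₕ x) →ₕ x ∈ V) (n : ℕ) : (b ^ n →ₕ x) →ₕ x ∈ V := by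
  induction n with
  | zero => rw [pow_zero, one_limp, limp_self]; exact hV.one_mem
  | succ n ih =>
    obtain ⟨v, hv, hvx⟩ := hV.limp_mem_iff.1 ih
    obtain ⟨w, hw, hwx⟩ := hV.limp_mem_iff.1 h
    refine hV.limp_mem_iff.2 ⟨w * v, hV.mul_mem _ _ hw hv, ?_⟩
    rw [pow_succ', mul_limp, mul_assoc]
    refine (mul_le_mul_right ?_ w).trans hwx
    rw [← mul_le_iff_le_limp, mul_assoc]
    exact (mul_le_mul_right (limp_mul_le _ _) v).trans hvx

theorem IsFilter.pow_rimp_rimp_mem {V : Set M} (hV : IsFilter V) {b x : M}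
    (h : (b ⇝ₕ x) ⇝ₕ x ∈ V) (n : ℕ) : (b ^ n ⇝ₕ x) ⇝ₕ x ∈ V := by
  induction n with
  | zero => rw [pow_zero, one_rimp, rimp_self]; exact hV.one_mem
  | succ n ih =>
    obtain ⟨v, hv, hvx⟩ := hV.rimp_mem_iff.1 ih
    obtain ⟨w, hw, hwx⟩ := hV.rimp_mem_iff.1 h
    refine hV.rimp_mem_iff.2 ⟨v * w, hV.mul_mem _ _ hv hw, ?_⟩
    rw [pow_succ, mul_rimp, ← mul_assoc]
    refine (mul_le_mul_left ?_ w).trans hwx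
    rw [← mul_le_iff_le_rimp, ← mul_assoc]
    exact (mul_le_mul_left (mul_rimp_le _ _) v).trans hvx

theorem IsValue.rimp_mem_of_limp_mem (h : ∀ x y : M, (x →ₕ y) ⇝ₕ y = (x ⇝ₕ y) →ₕ y)
    (hsq : ∀ x y : M, (x * x) * (y * y) ≤ y * x) {g : M} {V : Set M} (hV : IsValue g V)
    {x y : M} (hx : x ∈ cover g V) (hxy : x →ₕ y ∈ V) : x ⇝ₕ y ∈ V := by
  by_contra hb
  have hF := hV.isFilter
  set b := x ⇝ₕ y
  set z := b →ₕ y with hzdef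
  have hxz : x ≤ z := mul_le_iff_le_limp.1 (mul_rimp_le x y)
  have hz : z = (x →ₕ y) ⇝ₕ y := (h x y).symm
  have haz : (x →ₕ y) * z = y := by rw [hz, mul_rimp_of_le (le_limp x y)]
  -- Here `a(b → z)b ≤ az = y` with `a = x → y`, so `a(b → z) ≤ b → y = z`.
  have hbz : (b →ₕ z) →ₕ z ∈ V := by
    refine hF.limp_mem_iff.2 ⟨_, hxy, ?_⟩
    rw [hzdef, ← mul_le_iff_le_limp, ← hzdef, mul_assoc]
    exact (mul_le_mul_right (limp_mul_le b z) _).trans haz.le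
  obtain ⟨n, v, hv, hvz⟩ := hV.exists_mul_pow_le hsq hb
    ((isFilter_filterGen _).up_mem _ _ hxz hx)
  have hzV : z ∈ V := hF.mem_of_limp (hF.pow_limp_limp_mem hbz n) (hF.limp_mem_iff.2 ⟨v, hv, hvz⟩)
  exact hb (hF.up_mem _ _ (le_rimp x y) (haz ▸ hF.mul_mem _ _ hxy hzV))

theorem IsValue.limp_mem_of_rimp_mem (h : ∀ x y : M, (x →ₕ y) ⇝ₕ y = (x ⇝ₕ y) →ₕ y)
    (hsq : ∀ x y : M, (x * x) * (y * y) ≤ y * x) {g : M} {V : Set M} (hV : IsValue g V)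
    {x y : M} (hx : x ∈ cover g V) (hxy : x ⇝ₕ y ∈ V) : x →ₕ y ∈ V := by
  by_contra ha
  have hF := hV.isFilter
  set a := x →ₕ y
  set z := a ⇝ₕ y with hzdef
  have hxz : x ≤ z := mul_le_iff_le_rimp.1 (limp_mul_le x y)
  have hz : z = (x ⇝ₕ y) →ₕ y := h x y
  have hzb : z * (x ⇝ₕ y) = y := by rw [hz, limp_mul_of_le (le_rimp x y)]
  -- Dually, `a(a ⇝ z)(x ⇝ y) ≤ z(x ⇝ y) = y`.
  have haz : (a ⇝ₕ z) ⇝ₕ z ∈ V := by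
    refine hF.rimp_mem_iff.2 ⟨_, hxy, ?_⟩
    rw [hzdef, ← mul_le_iff_le_rimp, ← hzdef, ← mul_assoc]
    exact (mul_le_mul_left (mul_rimp_le a z) _).trans hzb.le
  obtain ⟨n, v, hv, hvz⟩ := hV.exists_pow_mul_le hsq ha
    ((isFilter_filterGen _).up_mem _ _ hxz hx)
  have hzV : z ∈ V := hF.mem_of_rimp (hF.pow_rimp_rimp_mem haz n) (hF.rimp_mem_iff.2 ⟨v, hv, hvz⟩)
  exact ha (hF.up_mem _ _ (le_limp x y) (hzb ▸ hF.mul_mem _ _ hzV hxy))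

end PseudoHoop

theorem theorem6p12 {M : Type*} [PseudoHoop M] (hM : PseudoHoop.IsBasic M)
    (h : ∀ x y : M, (x →ₕ y) ⇝ₕ y = (x ⇝ₕ y) →ₕ y) :
    PseudoHoop.IsNormalValued M ↔ ∀ x y : M, (x * x) * (y * y) ≤ y * x :=
  ⟨fun hN => hN.sq_mul_sq_le hM, fun hsq _ _ _ hV _ hx _ _ =>
    ⟨hV.rimp_mem_of_limp_mem h hsq hx, hV.limp_mem_of_rimp_mem h hsq hx⟩⟩
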